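/- Let $D$ be an integral domain with quotient field $K$, let $L$ be a field extension of $K$, let $X$ be an indeterminate over $L$, and let $R = D + XL[X]$ be the ring of all polynomials in $L[X]$ whose constant coefficient lies in $D$. For an integral domain $A$ with quotient field $F$ and a nonzero fractional ideal $I$ of $A$ put $I^{-1}=\{x\in F : xI\subseteq A\}$, $I_v=(I^{-1})^{-1}$, $I_d = I$, and $I_t=\bigcup\{J_v : 0\ne J\subseteq I,\ J \text{ a finitely generated fractional ideal}\}$. For $\ast\in\{d,t\}$ write $I^\ast$ for $I_d$, resp. $I_t$. A nonzero fractional ideal $I$ is a $\ast$-ideal if $I^\ast=I$, and it is $\ast$-invertible if $(II^{-1})^\ast=A$. A prime $\ast$-ideal is a nonzero prime ideal of $A$ that is a $\ast$-ideal. The domain $A$ is called $\ast$-sub-almost Bezout ($\ast$-SAB) (resp., $\ast$-sub-almost Prüfer ($\ast$-SAP)) if for every nonempty finite set of elements $x_1,\dots,x_n\in A\setminus\{0\}$ there are an integer $s\ge 1$ and a principal ideal (resp., an integral $\ast$-invertible $\ast$-ideal) $J$ of $A$ such that $(x_1,\dots,x_n)^s\subseteq J$ and $J\subseteq P$ for every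 prime $\ast$-ideal $P$ of $A$ that contains $(x_1,\dots,x_n)$. Then, for $\ast=d$ and for $\ast=t$: $D$ is a $\ast$-SAB domain if and only if $R$ is a $\ast$-SAB domain, and $D$ is a $\ast$-SAP domain if and only if $R$ is a $\ast$-SAP domain. (In particular, this holds for $L=K$, that is, for $R=D+XK[X]$.) -/

import Mathlib

open Polynomial
open scoped nonZeroDivisors

/-- A star operation on the domain `A` with quotient field `K`: a closure operation on the nonzero
fractional ideals of `A` that fixes principal ideals and commutes with multiplication by nonzero
elements of `K`. (The value at the zero fractional ideal is irrelevant: all the laws and all the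
uses concern nonzero fractional ideals.) -/
structure StarOperation (A K : Type*) [CommRing A] [IsDomain A] [Field K] [Algebra A K]
    [IsFractionRing A K] where
  /-- the map `I ↦ I^*` -/
  star : FractionalIdeal A⁰ K → FractionalIdeal A⁰ K
  star_principal : ∀ x : K, x ≠ 0 →
    star (FractionalIdeal.spanSingleton A⁰ x) = FractionalIdeal.spanSingleton A⁰ x
  star_smul : ∀ (x : K) (I : FractionalIdeal A⁰ K), x ≠ 0 → I ≠ 0 →
    star (FractionalIdeal.spanSingleton A⁰ x * I) = FractionalIdeal.spanSingleton A⁰ x * star I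
  le_star : ∀ I : FractionalIdeal A⁰ K, I ≠ 0 → I ≤ star I
  star_mono : ∀ I J : FractionalIdeal A⁰ K, I ≠ 0 → J ≠ 0 → I ≤ J → star I ≤ star J
  star_star : ∀ I : FractionalIdeal A⁰ K, I ≠ 0 → star (star I) = star I

section Operations

variable (A K : Type*) [CommRing A] [IsDomain A] [Field K] [Algebra A K] [IsFractionRing A K]

/-- The `d`-operation `I ↦ I`. -/
def dOperation : StarOperation A K where
  star I := I
  star_principal _ _ := rfl
  star_smul _ _ _ _ := rfl
  le_star _ _ := le_rfl
  star_mono _ _ _ _ h := h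
  star_star _ _ := rfl

variable {A K}

/-- The `v`-closure `I_v = (I⁻¹)⁻¹` of a fractional ideal. -/
noncomputable def vClosure (I : FractionalIdeal A⁰ K) : FractionalIdeal A⁰ K := (I⁻¹)⁻¹

theorem inv_ne_zero_of_ne_zero {I : FractionalIdeal A⁰ K} (hI : I ≠ 0) : I⁻¹ ≠ 0 := by
  intro h
  obtain ⟨a, J, ha, rfl⟩ := FractionalIdeal.exists_eq_spanSingleton_mul I
  have hx : algebraMap A K a ∈
      (FractionalIdeal.spanSingleton A⁰ ((algebraMap A K) a)⁻¹ *
        (J : FractionalIdeal A⁰ K))⁻¹ := by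
    rw [FractionalIdeal.mem_inv_iff hI]
    intro y hy
    obtain ⟨z, hz, rfl⟩ := FractionalIdeal.mem_singleton_mul.1 hy
    have ha' : algebraMap A K a ≠ 0 := by simpa using ha
    rw [mul_inv_cancel_left₀ ha']
    exact FractionalIdeal.coeIdeal_le_one hz
  rw [h, FractionalIdeal.mem_zero_iff] at hx
  exact ha (by simpa using hx)

theorem le_vClosure (I : FractionalIdeal A⁰ K) : I ≤ vClosure I := by
  rcases eq_or_ne I 0 with rfl | hI
  · exact zero_le
  intro x hx
  refine (FractionalIdeal.mem_inv_iff (inv_ne_zero_of_ne_zero hI)).2 fun y hy => ?_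
  rw [mul_comm]
  exact (FractionalIdeal.mem_inv_iff hI).1 hy x hx

theorem vClosure_zero : vClosure (0 : FractionalIdeal A⁰ K) = 0 := by
  simp only [vClosure, FractionalIdeal.inv_zero']

theorem vClosure_mono {I J : FractionalIdeal A⁰ K} (h : I ≤ J) : vClosure I ≤ vClosure J := by
  rcases eq_or_ne I 0 with rfl | hI
  · rw [vClosure_zero]; exact zero_le
  have hJ : J ≠ 0 := fun h0 => hI (le_antisymm (h0 ▸ h) zero_le)
  exact FractionalIdeal.inv_anti_mono (inv_ne_zero_of_ne_zero hJ) (inv_ne_zero_of_ne_zero hI)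
    (FractionalIdeal.inv_anti_mono hI hJ h)

theorem vClosure_vClosure (I : FractionalIdeal A⁰ K) : vClosure (vClosure I) = vClosure I := by
  rcases eq_or_ne I 0 with rfl | hI
  · simp only [vClosure_zero]
  refine le_antisymm ?_ (le_vClosure _)
  have h1 : I⁻¹ ≠ 0 := inv_ne_zero_of_ne_zero hI
  have h2 := inv_ne_zero_of_ne_zero h1
  have h3 := inv_ne_zero_of_ne_zero h2
  exact FractionalIdeal.inv_anti_mono h1 h3 (le_vClosure I⁻¹)

theorem inv_spanSingleton_mul {x : K} (hx : x ≠ 0) {I : FractionalIdeal A⁰ K} (hI : I ≠ 0) :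
    (FractionalIdeal.spanSingleton A⁰ x * I)⁻¹ = FractionalIdeal.spanSingleton A⁰ x⁻¹ * I⁻¹ := by
  have hne : FractionalIdeal.spanSingleton A⁰ x * I ≠ 0 :=
    fun h => hI <| by
      have h' := congrArg (FractionalIdeal.spanSingleton A⁰ x⁻¹ * ·) h
      simpa only [← mul_assoc, FractionalIdeal.spanSingleton_mul_spanSingleton,
        inv_mul_cancel₀ hx, FractionalIdeal.spanSingleton_one, one_mul, mul_zero] using h'
  ext y
  rw [FractionalIdeal.mem_inv_iff hne, FractionalIdeal.mem_singleton_mul]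
  constructor
  · intro h
    refine ⟨x * y, (FractionalIdeal.mem_inv_iff hI).2 fun z hz => ?_, by field_simp⟩
    have := h (x * z) (FractionalIdeal.mem_singleton_mul.2 ⟨z, hz, rfl⟩)
    rwa [← mul_assoc, mul_comm y x] at this
  · rintro ⟨w, hw, rfl⟩ z hz
    obtain ⟨u, hu, rfl⟩ := FractionalIdeal.mem_singleton_mul.1 hz
    have := (FractionalIdeal.mem_inv_iff hI).1 hw u hu
    have e : x⁻¹ * w * (x * u) = w * u := by field_simp
    rwa [e]

theorem vClosure_smul {x : K} (hx : x ≠ 0) (I : FractionalIdeal A⁰ K) :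
    vClosure (FractionalIdeal.spanSingleton A⁰ x * I) =
      FractionalIdeal.spanSingleton A⁰ x * vClosure I := by
  rcases eq_or_ne I 0 with rfl | hI
  · simp [vClosure_zero]
  rw [vClosure, inv_spanSingleton_mul hx hI,
    inv_spanSingleton_mul (inv_ne_zero hx) (inv_ne_zero_of_ne_zero hI), inv_inv, vClosure]

theorem vClosure_spanSingleton (x : K) :
    vClosure (FractionalIdeal.spanSingleton A⁰ x) = FractionalIdeal.spanSingleton A⁰ x := by
  simp [vClosure, FractionalIdeal.spanSingleton_inv]

/-- The `t`-closure `I_t = ⋃ {J_v | J ⊆ I, J a finitely generated fractional ideal}`. (Admitting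
`J = 0` here changes nothing for `I ≠ 0`, because `0_v = 0`.) -/
noncomputable def tClosure (I : FractionalIdeal A⁰ K) : FractionalIdeal A⁰ K :=
  ⟨{ carrier := {x | ∃ J : FractionalIdeal A⁰ K,
        J ≤ I ∧ (J : Submodule A K).FG ∧ x ∈ vClosure J}
     add_mem' := by
        rintro x y ⟨J, hJ, hJf, hx⟩ ⟨J', hJ', hJf', hy⟩
        refine ⟨J ⊔ J', sup_le hJ hJ', ?_, ?_⟩
        · rw [FractionalIdeal.coe_sup]
          exact hJf.sup hJf'
        · exact Submodule.add_mem (vClosure (J ⊔ J') : Submodule A K)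
            (vClosure_mono le_sup_left hx) (vClosure_mono le_sup_right hy)
     zero_mem' := ⟨0, zero_le, by simpa using Submodule.fg_bot, by
        rw [vClosure_zero]; exact FractionalIdeal.zero_mem _⟩
     smul_mem' := by
        rintro a x ⟨J, hJ, hJf, hx⟩
        exact ⟨J, hJ, hJf, Submodule.smul_mem (vClosure J : Submodule A K) a hx⟩ }, by
    obtain ⟨a, ha, h⟩ := (vClosure I).isFractional
    refine ⟨a, ha, ?_⟩
    rintro x ⟨J, hJ, -, hx⟩
    exact h x (vClosure_mono hJ hx)⟩

theorem mem_tClosure {I : FractionalIdeal A⁰ K} {x : K} :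
    x ∈ tClosure I ↔ ∃ J : FractionalIdeal A⁰ K,
      J ≤ I ∧ (J : Submodule A K).FG ∧ x ∈ vClosure J :=
  Iff.rfl

theorem tClosure_mono {I J : FractionalIdeal A⁰ K} (h : I ≤ J) : tClosure I ≤ tClosure J := by
  rintro x ⟨J', hJ', hf, hx⟩
  exact ⟨J', hJ'.trans h, hf, hx⟩

theorem tClosure_le_vClosure (I : FractionalIdeal A⁰ K) : tClosure I ≤ vClosure I := by
  rintro x ⟨J, hJ, -, hx⟩
  exact vClosure_mono hJ hx

set_option linter.unusedSectionVars false in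
theorem fg_spanSingleton (x : K) :
    (FractionalIdeal.spanSingleton A⁰ x : Submodule A K).FG := by
  rw [FractionalIdeal.coe_spanSingleton]
  exact Submodule.fg_span_singleton x

theorem le_tClosure (I : FractionalIdeal A⁰ K) : I ≤ tClosure I := by
  intro x hx
  exact ⟨FractionalIdeal.spanSingleton A⁰ x, FractionalIdeal.spanSingleton_le_iff_mem.2 hx,
    fg_spanSingleton x, le_vClosure _ (FractionalIdeal.mem_spanSingleton_self A⁰ x)⟩

/-- A finitely generated fractional ideal inside `I_t` lies in `J_v` for some finitely generated
`J ⊆ I`. -/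
theorem exists_fg_of_le_tClosure {I F : FractionalIdeal A⁰ K} (hF : (F : Submodule A K).FG)
    (h : F ≤ tClosure I) :
    ∃ J : FractionalIdeal A⁰ K, J ≤ I ∧ (J : Submodule A K).FG ∧ F ≤ vClosure J := by
  obtain ⟨s, hs⟩ := hF
  have key : ∀ s : Finset K, (∀ x ∈ s, x ∈ tClosure I) →
      ∃ J : FractionalIdeal A⁰ K, J ≤ I ∧ (J : Submodule A K).FG ∧ ∀ x ∈ s, x ∈ vClosure J := by
    classical
    intro s
    induction s using Finset.induction_on with
    | empty => exact fun _ => ⟨0, zero_le, by simpa using Submodule.fg_bot, by simp⟩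
    | insert a s _ ih =>
      intro hs
      obtain ⟨J, hJ, hJf, hJs⟩ := ih fun x hx => hs x (Finset.mem_insert_of_mem hx)
      obtain ⟨J', hJ', hJf', ha⟩ := hs a (Finset.mem_insert_self a s)
      refine ⟨J ⊔ J', sup_le hJ hJ', ?_, ?_⟩
      · rw [FractionalIdeal.coe_sup]
        exact hJf.sup hJf'
      · intro x hx
        rcases Finset.mem_insert.1 hx with rfl | hx
        · exact vClosure_mono le_sup_right ha
        · exact vClosure_mono le_sup_left (hJs x hx)
  obtain ⟨J, hJ, hJf, hJs⟩ := key s fun x hx => h (show x ∈ (F : Submodule A K) from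
    hs ▸ Submodule.subset_span hx)
  refine ⟨J, hJ, hJf, ?_⟩
  rw [← FractionalIdeal.coe_le_coe, ← hs, Submodule.span_le]
  exact hJs

theorem tClosure_tClosure (I : FractionalIdeal A⁰ K) : tClosure (tClosure I) = tClosure I := by
  refine le_antisymm ?_ (le_tClosure _)
  rintro x ⟨F, hF, hFf, hx⟩
  obtain ⟨J, hJ, hJf, hFJ⟩ := exists_fg_of_le_tClosure hFf hF
  refine ⟨J, hJ, hJf, ?_⟩
  have := vClosure_mono hFJ hx
  rwa [vClosure_vClosure] at this

theorem smul_tClosure_le {x : K} (hx : x ≠ 0) (I : FractionalIdeal A⁰ K) :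
    FractionalIdeal.spanSingleton A⁰ x * tClosure I ≤
      tClosure (FractionalIdeal.spanSingleton A⁰ x * I) := by
  intro y hy
  obtain ⟨z, ⟨J, hJ, hJf, hz⟩, rfl⟩ := FractionalIdeal.mem_singleton_mul.1 hy
  refine ⟨FractionalIdeal.spanSingleton A⁰ x * J, mul_le_mul_right hJ _, ?_, ?_⟩
  · rw [FractionalIdeal.coe_mul]
    exact (fg_spanSingleton x).mul hJf
  · rw [vClosure_smul hx]
    exact FractionalIdeal.mem_singleton_mul.2 ⟨z, hz, rfl⟩

theorem tClosure_smul {x : K} (hx : x ≠ 0) (I : FractionalIdeal A⁰ K) :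
    tClosure (FractionalIdeal.spanSingleton A⁰ x * I) =
      FractionalIdeal.spanSingleton A⁰ x * tClosure I := by
  refine le_antisymm ?_ (smul_tClosure_le hx I)
  have h := mul_le_mul_right (smul_tClosure_le (inv_ne_zero hx)
    (FractionalIdeal.spanSingleton A⁰ x * I)) (FractionalIdeal.spanSingleton A⁰ x)
  simpa only [← mul_assoc, FractionalIdeal.spanSingleton_mul_spanSingleton, mul_inv_cancel₀ hx,
    inv_mul_cancel₀ hx, FractionalIdeal.spanSingleton_one, one_mul] using h

variable (A K)

/-- The `t`-operation. -/
noncomputable def tOperation : StarOperation A K where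
  star := tClosure
  star_principal x _ := le_antisymm
    ((tClosure_le_vClosure _).trans (vClosure_spanSingleton x).le) (le_tClosure _)
  star_smul _ I hx _ := tClosure_smul hx I
  le_star I _ := le_tClosure I
  star_mono _ _ _ _ h := tClosure_mono h
  star_star I _ := tClosure_tClosure I

end Operations

section Domains

variable {A K : Type*} [CommRing A] [IsDomain A] [Field K] [Algebra A K] [IsFractionRing A K]

/-- A nonzero fractional ideal `I` is a `*`-ideal if `I^* = I`. -/
def IsStarIdeal (s : StarOperation A K) (I : FractionalIdeal A⁰ K) : Prop :=
  I ≠ 0 ∧ s.star I = I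

/-- A nonzero fractional ideal `I` is `*`-invertible if `(I I⁻¹)^* = A`. -/
def IsStarInvertible (s : StarOperation A K) (I : FractionalIdeal A⁰ K) : Prop :=
  I ≠ 0 ∧ s.star (I * I⁻¹) = 1

/-- `J` lies in each prime `*`-ideal of `A` that contains `I`. -/
def InEachPrimeStarIdealOver (s : StarOperation A K) (I J : Ideal A) : Prop :=
  ∀ P : Ideal A, P.IsPrime → IsStarIdeal s (P : FractionalIdeal A⁰ K) → I ≤ P → J ≤ P

/-- `A` is a `*`-sub-almost Bezout (`*`-SAB) domain. -/
def IsSubAlmostBezout (s : StarOperation A K) : Prop :=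
  ∀ S : Finset A, S.Nonempty → (∀ x ∈ S, x ≠ 0) →
    ∃ n : ℕ, 0 < n ∧ ∃ J : Ideal A, J.IsPrincipal ∧
      Ideal.span (S : Set A) ^ n ≤ J ∧ InEachPrimeStarIdealOver s (Ideal.span (S : Set A)) J

/-- `A` is a `*`-sub-almost Prüfer (`*`-SAP) domain. -/
def IsSubAlmostPrufer (s : StarOperation A K) : Prop :=
  ∀ S : Finset A, S.Nonempty → (∀ x ∈ S, x ≠ 0) →
    ∃ n : ℕ, 0 < n ∧ ∃ J : Ideal A,
      (IsStarInvertible s (J : FractionalIdeal A⁰ K) ∧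
        IsStarIdeal s (J : FractionalIdeal A⁰ K)) ∧
      Ideal.span (S : Set A) ^ n ≤ J ∧ InEachPrimeStarIdealOver s (Ideal.span (S : Set A)) J

end Domains

/-- The subring `D + X L[X]` of `L[X]`: the polynomials over `L` whose constant coefficient lies in
(the image of) `D`. -/
noncomputable def dPlusXL (D L : Type*) [CommRing D] [Field L] [Algebra D L] : Subring L[X] :=
  (algebraMap D L).range.comap (Polynomial.constantCoeff : L[X] →+* L)

theorem mem_dPlusXL {D L : Type*} [CommRing D] [Field L] [Algebra D L] {f : L[X]} :
    f ∈ dPlusXL D L ↔ ∃ (a : D) (g : L[X]), f = C (algebraMap D L a) + X * g := by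
  constructor
  · rintro ⟨a, ha⟩
    refine ⟨a, f.divX, ?_⟩
    have ha' : algebraMap D L a = f.coeff 0 := ha
    rw [ha', add_comm, Polynomial.X_mul_divX_add]
  · rintro ⟨a, g, rfl⟩
    exact ⟨a, by simp [Polynomial.constantCoeff_apply]⟩

set_option linter.unusedSectionVars false

namespace DPlusXL

/-! Write M = XL[X], the kernel of R → D. The map I ↦ I + M (`extend`) embeds the fractional ideals
of D in those of R. Nonzero elements of D are units of L, so for I ≠ 0 it respects products,
inverses, v- and t-closures (`extend_mul`, `extend_inv`, `tClosure_extend`). Hence *-ideals and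
*-invertibility transfer both ways, and ideals of R containing M correspond to ideals of D.

Descent (`IsSubAlmost.of_dPlusXL`): if S ⊆ D is nonempty without 0, an ideal J of R containing a
power of SR contains a nonzero constant, hence M, so J comes from D.

Ascent (`IsSubAlmost.to_dPlusXL`): let I be a finitely generated nonzero ideal of R. Then IL[X] =
fL[X] with f(0) ∈ {0, 1}, and Mf ⊆ I; so a prime over I contains f or M. If f(0) = 0, then I² ⊆ fR,
and fR lies in every prime over I since f ∈ M. If f(0) = 1, then I ⊆ f(I₀ + M), where I₀ ≠ 0 is the
ideal of constant terms of I; an ideal J₀ chosen for I₀ in D yields f(J₀ + M). -/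

theorem fractionalIdeal_add_mem {A K : Type*} [CommRing A] [CommRing K] [Algebra A K]
    {I : FractionalIdeal A⁰ K} {x y : K} (hx : x ∈ I) (hy : y ∈ I) : x + y ∈ I :=
  Submodule.add_mem (I : Submodule A K) hx hy

theorem fractionalIdeal_exists_mem_ne_zero {A K : Type*} [CommRing A] [CommRing K] [Algebra A K]
    {I : FractionalIdeal A⁰ K} (hI : I ≠ 0) : ∃ a ∈ I, a ≠ 0 := by
  by_contra! h
  exact hI (FractionalIdeal.eq_zero_iff.2 h)

/-! ### Constant terms, and ideals of D + XL[X] containing XL[X] -/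

section ConstantTerm

variable {D L : Type*} [CommRing D] [Field L] [Algebra D L]

theorem mul_mem_of_coeff_zero {f : L[X]} (hf : f.coeff 0 = 0) : f ∈ dPlusXL D L :=
  ⟨0, by simp [hf]⟩

variable (D) in
/-- The element `X` of `D + X L[X]`. -/
noncomputable def varX : dPlusXL D L := ⟨X, mul_mem_of_coeff_zero (by simp)⟩

@[simp] theorem coe_varX : ((varX D : dPlusXL D L) : L[X]) = X := rfl

theorem varX_ne_zero : (varX D : dPlusXL D L) ≠ 0 :=
  fun h => X_ne_zero (R := L) (congrArg Subtype.val h)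

variable (D L) in
/-- The embedding of `D` into `D + X L[X]`. -/
noncomputable def constants : D →+* dPlusXL D L :=
  (C.comp (algebraMap D L)).codRestrict _ fun a => ⟨a, by simp⟩

@[simp] theorem coe_constants (a : D) : (constants D L a : L[X]) = C (algebraMap D L a) := rfl

/-- The elements of `L[X]` generated by an ideal `I` of `D + X L[X]` are moved into `I` by each
polynomial with vanishing constant coefficient. -/
theorem mul_mem_of_mem_map {I : Ideal (dPlusXL D L)} {f h : L[X]}
    (hf : f ∈ I.map (dPlusXL D L).subtype) (hh : h.coeff 0 = 0) {r : dPlusXL D L}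
    (hr : (r : L[X]) = h * f) : r ∈ I := by
  have key : ∀ f ∈ I.map (dPlusXL D L).subtype, ∀ h : L[X], h.coeff 0 = 0 →
      ∃ r ∈ I, (r : L[X]) = h * f := by
    intro f hf
    unfold Ideal.map at hf
    induction hf using Submodule.span_induction with
    | mem x hx =>
      obtain ⟨s, hs, rfl⟩ := hx
      exact fun h hh => ⟨⟨h, mul_mem_of_coeff_zero hh⟩ * s, I.mul_mem_left _ hs, by simp⟩
    | zero => exact fun h _ => ⟨0, I.zero_mem, by simp⟩
    | add x y _ _ hx hy =>
      intro h hh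
      obtain ⟨r, hr, hr'⟩ := hx h hh
      obtain ⟨s, hs, hs'⟩ := hy h hh
      exact ⟨r + s, I.add_mem hr hs, by rw [Subring.coe_add, hr', hs', mul_add]⟩
    | smul a x _ hx =>
      intro h hh
      obtain ⟨r, hr, hr'⟩ := hx (h * a) (by simp [mul_coeff_zero, hh])
      exact ⟨r, hr, by rw [hr', smul_eq_mul, mul_assoc]⟩
  obtain ⟨s, hs, hs'⟩ := key f hf h hh
  rwa [show r = s from Subtype.ext (hr.trans hs'.symm)]

variable [FaithfulSMul D L]

variable (D L) in
/-- The constant coefficient of an element of `D + X L[X]`, as an element of `D`. -/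
noncomputable def constTerm : dPlusXL D L →+* D where
  toFun r := Classical.choose r.2
  map_one' := FaithfulSMul.algebraMap_injective D L <| by
    rw [Classical.choose_spec (1 : dPlusXL D L).2]; simp
  map_zero' := FaithfulSMul.algebraMap_injective D L <| by
    rw [Classical.choose_spec (0 : dPlusXL D L).2]; simp
  map_add' r s := FaithfulSMul.algebraMap_injective D L <| by
    rw [map_add, Classical.choose_spec (r + s).2, Classical.choose_spec r.2,
      Classical.choose_spec s.2]
    simp
  map_mul' r s := FaithfulSMul.algebraMap_injective D L <| by
    rw [map_mul, Classical.choose_spec (r * s).2, Classical.choose_spec r.2,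
      Classical.choose_spec s.2]
    simp

theorem algebraMap_constTerm (r : dPlusXL D L) :
    algebraMap D L (constTerm D L r) = (r : L[X]).coeff 0 :=
  Classical.choose_spec r.2

theorem constTerm_eq_iff {r : dPlusXL D L} {a : D} :
    constTerm D L r = a ↔ (r : L[X]).coeff 0 = algebraMap D L a := by
  rw [← algebraMap_constTerm, (FaithfulSMul.algebraMap_injective D L).eq_iff]

@[simp] theorem constTerm_constants (a : D) : constTerm D L (constants D L a) = a := by
  simp [constTerm_eq_iff]

theorem constTerm_surjective : Function.Surjective (constTerm D L) :=
  fun a => ⟨constants D L a, constTerm_constants a⟩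

theorem mem_ker_constTerm {r : dPlusXL D L} :
    r ∈ RingHom.ker (constTerm D L) ↔ (r : L[X]).coeff 0 = 0 := by
  rw [RingHom.mem_ker, constTerm_eq_iff, map_zero]

theorem comap_constants_comap_constTerm (J : Ideal D) :
    (J.comap (constTerm D L)).comap (constants D L) = J := by
  ext a; simp

/-- An element differs from its constant term by an element of XL[X], so an ideal containing XL[X]
is determined by its constants. -/
theorem comap_constTerm_comap_constants {J : Ideal (dPlusXL D L)}
    (h : RingHom.ker (constTerm D L) ≤ J) :
    (J.comap (constants D L)).comap (constTerm D L) = J := by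
  ext r
  have h1 : r - constants D L (constTerm D L r) ∈ J := h (by simp [RingHom.mem_ker])
  simpa only [Ideal.mem_comap] using
    ⟨fun h2 => by simpa using J.add_mem h1 h2, fun h2 => by simpa using J.sub_mem h2 h1⟩

/-- Division by a is possible in L[X]; only the constant coefficient of the quotient has to be
checked. -/
theorem exists_constants_mul {a : D} (ha : a ≠ 0) {r : dPlusXL D L}
    (hr : a ∣ constTerm D L r) : constants D L a ∣ r := by
  obtain ⟨d, hd⟩ := hr
  have ha' : algebraMap D L a ≠ 0 := by simpa using ha
  refine ⟨⟨C (algebraMap D L a)⁻¹ * r, d, ?_⟩, Subtype.ext ?_⟩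
  · rw [constantCoeff_apply, coeff_C_mul, ← algebraMap_constTerm, hd, map_mul,
      inv_mul_cancel_left₀ ha']
  · simp [← mul_assoc, ← C_mul, ha']

theorem ker_le_of_constants_mem {J : Ideal (dPlusXL D L)} {a : D} (ha : a ≠ 0)
    (h : constants D L a ∈ J) : RingHom.ker (constTerm D L) ≤ J := fun r hr =>
  J.mem_of_dvd (exists_constants_mul ha (by rw [(RingHom.mem_ker).1 hr]; exact dvd_zero a)) h

/-- X need not divide Xg in R, but (Xg)² = X · Xg² with Xg² in R, and P is prime. -/
theorem ker_le_of_varX_mem {P : Ideal (dPlusXL D L)} (hP : P.IsPrime) (h : varX D ∈ P) :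
    RingHom.ker (constTerm D L) ≤ P := by
  intro r hr
  obtain ⟨g, hg⟩ := X_dvd_iff.2 (mem_ker_constTerm.1 hr)
  refine hP.mem_of_pow_mem 2 (P.mem_of_dvd ⟨⟨X * g ^ 2, mul_mem_of_coeff_zero (by simp)⟩,
    Subtype.ext ?_⟩ h)
  simp only [Subring.coe_pow, Subring.coe_mul, coe_varX, hg]
  ring

/-- If J = bD with b ≠ 0, then b is a unit of L, so bD + XL[X] = bR. -/
theorem isPrincipal_comap_constTerm {J : Ideal D} (hJ : J.IsPrincipal) (h0 : J ≠ ⊥) :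
    (J.comap (constTerm D L)).IsPrincipal := by
  obtain ⟨b, rfl⟩ := hJ
  have hb : b ≠ 0 := by rintro rfl; simp at h0
  refine ⟨constants D L b, le_antisymm (fun r hr => ?_) ?_⟩
  · exact Ideal.mem_span_singleton.2 (exists_constants_mul hb (Ideal.mem_span_singleton.1 hr))
  · refine (Ideal.span_singleton_le_iff_mem _).2 ?_
    simp

end ConstantTerm

/-! ### Extension of fractional ideals and of the v- and t-closures -/

section Extension

variable {D K L F : Type*} [CommRing D] [IsDomain D]
    [Field K] [Algebra D K] [IsFractionRing D K]
    [Field L] [Algebra K L] [Algebra D L] [IsScalarTower D K L]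
    [Field F] [Algebra (dPlusXL D L) F] [IsFractionRing (dPlusXL D L) F]

variable (D F) in
/-- The embedding of `L[X]` into the quotient field of `D + X L[X]`. -/
noncomputable def polyMap : L[X] →+* F where
  -- Xf lies in R for every f in L[X], so f is realized as the fraction Xf / X.
  toFun f := algebraMap (dPlusXL D L) F ⟨X * f, mul_mem_of_coeff_zero (by simp)⟩ /
    algebraMap (dPlusXL D L) F (varX D)
  map_one' := by
    have h : algebraMap (dPlusXL D L) F (varX D) ≠ 0 := by simpa using varX_ne_zero
    rw [div_eq_one_iff_eq h]
    exact congrArg _ (Subtype.ext (mul_one _))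
  map_zero' := by
    rw [div_eq_zero_iff]
    exact Or.inl ((congrArg _ (Subtype.ext (mul_zero _))).trans (map_zero _))
  map_add' f g := by
    rw [← add_div, ← map_add]
    exact congrArg (fun r => algebraMap (dPlusXL D L) F r / _) (Subtype.ext (mul_add _ _ _))
  map_mul' f g := by
    have h : algebraMap (dPlusXL D L) F (varX D) ≠ 0 := by simpa using varX_ne_zero
    rw [div_mul_div_comm, div_eq_div_iff h (mul_ne_zero h h), ← map_mul, ← map_mul, ← map_mul,
      ← map_mul]
    refine congrArg _ (Subtype.ext ?_)
    simp only [Subring.coe_mul, coe_varX]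
    ring

theorem polyMap_coe (r : dPlusXL D L) : polyMap D F (r : L[X]) = algebraMap _ F r := by
  have h : algebraMap (dPlusXL D L) F (varX D) ≠ 0 := by simpa using varX_ne_zero
  rw [polyMap, RingHom.coe_mk, MonoidHom.coe_mk, OneHom.coe_mk, div_eq_iff h, ← map_mul]
  exact congrArg _ (Subtype.ext (mul_comm _ _))

theorem polyMap_injective : Function.Injective (polyMap D F : L[X] →+* F) := by
  refine (injective_iff_map_eq_zero _).2 fun f hf => ?_
  have h : polyMap D F (X * f : L[X]) = 0 := by rw [map_mul, hf, mul_zero]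
  rw [show (X * f : L[X]) = (⟨X * f, mul_mem_of_coeff_zero (by simp)⟩ : dPlusXL D L) from rfl,
    polyMap_coe, map_eq_zero_iff _ (IsFractionRing.injective _ F)] at h
  simpa using congrArg Subtype.val h

variable (L F) in
/-- The extension `I + X L[X]` to `D + X L[X]` of a fractional ideal `I` of `D`. -/
noncomputable def extend (I : FractionalIdeal D⁰ K) : FractionalIdeal (dPlusXL D L)⁰ F :=
  ⟨{  carrier := {x | ∃ f : L[X], (∃ a ∈ I, algebraMap K L a = f.coeff 0) ∧ polyMap D F f = x}
      add_mem' := by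
        rintro _ _ ⟨f, ⟨a, ha, hf⟩, rfl⟩ ⟨g, ⟨b, hb, hg⟩, rfl⟩
        exact ⟨f + g, ⟨a + b, Submodule.add_mem (I : Submodule D K) ha hb, by simp [hf, hg]⟩,
          map_add _ _ _⟩
      zero_mem' := ⟨0, ⟨0, I.zero_mem, by simp⟩, map_zero _⟩
      smul_mem' := by
        rintro r _ ⟨f, ⟨a, ha, hf⟩, rfl⟩
        obtain ⟨d, hd⟩ := r.2
        refine ⟨r * f, ⟨d • a, Submodule.smul_mem (I : Submodule D K) d ha, ?_⟩, ?_⟩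
        · rw [Algebra.smul_def, map_mul, ← IsScalarTower.algebraMap_apply, hd, hf,
            mul_coeff_zero, constantCoeff_apply]
        · rw [map_mul, polyMap_coe, Algebra.smul_def] }, by
    refine ⟨varX D, mem_nonZeroDivisors_of_ne_zero varX_ne_zero, ?_⟩
    rintro _ ⟨f, -, rfl⟩
    refine ⟨⟨X * f, mul_mem_of_coeff_zero (by simp)⟩, ?_⟩
    rw [← polyMap_coe, Algebra.smul_def, ← polyMap_coe, ← map_mul]
    rfl⟩

theorem polyMap_mem_extend {I : FractionalIdeal D⁰ K} {f : L[X]} :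
    polyMap D F f ∈ extend L F I ↔ ∃ a ∈ I, algebraMap K L a = f.coeff 0 := by
  refine ⟨?_, fun h => ⟨f, h, rfl⟩⟩
  rintro ⟨g, hg, h⟩
  rwa [← polyMap_injective h]

theorem polyMap_C_mem_extend {I : FractionalIdeal D⁰ K} {a : K} :
    polyMap D F (C (algebraMap K L a)) ∈ extend L F I ↔ a ∈ I := by
  rw [polyMap_mem_extend]
  refine ⟨?_, fun h => ⟨a, h, by simp⟩⟩
  rintro ⟨b, hb, h⟩
  rw [coeff_C_zero] at h
  rwa [← (algebraMap K L).injective h]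

theorem polyMap_mem_extend_of_coeff_zero (I : FractionalIdeal D⁰ K) {f : L[X]}
    (hf : f.coeff 0 = 0) : polyMap D F f ∈ extend L F I :=
  polyMap_mem_extend.2 ⟨0, I.zero_mem, by simp [hf]⟩

theorem polyMap_mem_one {f : L[X]} :
    polyMap D F f ∈ (1 : FractionalIdeal (dPlusXL D L)⁰ F) ↔ f ∈ dPlusXL D L := by
  rw [FractionalIdeal.mem_one_iff]
  refine ⟨?_, fun h => ⟨⟨f, h⟩, (polyMap_coe ⟨f, h⟩).symm⟩⟩
  rintro ⟨r, hr⟩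
  rw [← polyMap_coe] at hr
  rw [← polyMap_injective hr]
  exact r.2

/-- XL[X] is present even for I = 0; therefore the laws for inverses and closures below concern
nonzero ideals. -/
theorem extend_ne_zero (I : FractionalIdeal D⁰ K) : extend L F I ≠ 0 := by
  intro h
  have hX := polyMap_mem_extend_of_coeff_zero (F := F) (L := L) I (f := X) (by simp)
  rw [h, FractionalIdeal.mem_zero_iff, map_eq_zero_iff _ polyMap_injective] at hX
  exact X_ne_zero hX

theorem extend_le_extend {I J : FractionalIdeal D⁰ K} :
    extend L F I ≤ extend L F J ↔ I ≤ J := by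
  constructor
  · exact fun h a ha => polyMap_C_mem_extend.1 (h (polyMap_C_mem_extend.2 ha))
  · rintro h _ ⟨f, ⟨a, ha, hf⟩, rfl⟩
    exact ⟨f, ⟨a, h ha, hf⟩, rfl⟩

theorem extend_injective :
    Function.Injective (extend L F : FractionalIdeal D⁰ K → FractionalIdeal (dPlusXL D L)⁰ F) :=
  fun _ _ h => le_antisymm (extend_le_extend.1 h.le) (extend_le_extend.1 h.ge)

theorem extend_one :
    extend L F (1 : FractionalIdeal D⁰ K) = 1 := by
  ext x
  constructor
  · rintro ⟨f, ⟨a, ha, hf⟩, rfl⟩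
    obtain ⟨d, rfl⟩ := (FractionalIdeal.mem_one_iff _).1 ha
    exact polyMap_mem_one.2 ⟨d, by rw [← IsScalarTower.algebraMap_apply] at hf; exact hf⟩
  · intro hx
    obtain ⟨r, rfl⟩ := (FractionalIdeal.mem_one_iff _).1 hx
    obtain ⟨d, hd⟩ := r.2
    rw [← polyMap_coe]
    refine polyMap_mem_extend.2 ⟨algebraMap D K d, (FractionalIdeal.mem_one_iff _).2 ⟨d, rfl⟩, ?_⟩
    rw [← IsScalarTower.algebraMap_apply]
    exact hd

/-- With 0 ≠ a ∈ I one has f = a · (a⁻¹f), and a⁻¹f still has zero constant coefficient. -/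
theorem polyMap_mem_mul {I J : FractionalIdeal D⁰ K} (hI : I ≠ 0) {f : L[X]}
    (hf : f.coeff 0 = 0) : polyMap D F f ∈ extend L F I * extend L F J := by
  obtain ⟨a, ha, ha0⟩ := fractionalIdeal_exists_mem_ne_zero hI
  have h0 : algebraMap K L a ≠ 0 := by simpa using ha0
  have e : f = C (algebraMap K L a) * (C (algebraMap K L a)⁻¹ * f) := by
    simp [← mul_assoc, ← C_mul, h0]
  rw [e, map_mul]
  exact FractionalIdeal.mul_mem_mul (polyMap_C_mem_extend.2 ha)
    (polyMap_mem_extend_of_coeff_zero J (by simp [hf]))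

theorem polyMap_mem_of_C_mem {I : FractionalIdeal (dPlusXL D L)⁰ F} {f : L[X]}
    (h0 : ∀ g : L[X], g.coeff 0 = 0 → polyMap D F g ∈ I)
    (h : polyMap D F (C (f.coeff 0)) ∈ I) : polyMap D F f ∈ I := by
  rw [← sub_add_cancel f (C (f.coeff 0)), map_add]
  exact fractionalIdeal_add_mem (h0 _ (by simp)) h

theorem extend_mul {I J : FractionalIdeal D⁰ K} (hI : I ≠ 0) :
    extend L F (I * J) = extend L F I * extend L F J := by
  refine le_antisymm ?_ (FractionalIdeal.mul_le.2 ?_)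
  · rintro _ ⟨f, ⟨c, hc, hf⟩, rfl⟩
    refine polyMap_mem_of_C_mem (fun g hg => polyMap_mem_mul hI hg) ?_
    rw [← hf]
    refine FractionalIdeal.mul_induction_on hc (fun a ha b hb => ?_) fun a b ha hb => ?_
    · rw [map_mul, C_mul, map_mul]
      exact FractionalIdeal.mul_mem_mul (polyMap_C_mem_extend.2 ha) (polyMap_C_mem_extend.2 hb)
    · rw [map_add, C_add, map_add]
      exact fractionalIdeal_add_mem ha hb
  · rintro _ ⟨f, ⟨a, ha, hf⟩, rfl⟩ _ ⟨g, ⟨b, hb, hg⟩, rfl⟩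
    exact ⟨f * g, ⟨a * b, FractionalIdeal.mul_mem_mul ha hb, by
      rw [map_mul, hf, hg, mul_coeff_zero]⟩, map_mul _ _ _⟩

/-- For 0 ≠ a ∈ I, xa ∈ R forces x into a⁻¹R, so x is a polynomial over L whose constant coefficient
lies in K. The remaining conditions then only involve that coefficient. -/
theorem extend_inv {I : FractionalIdeal D⁰ K} (hI : I ≠ 0) :
    (extend L F I)⁻¹ = extend L F I⁻¹ := by
  ext x
  rw [FractionalIdeal.mem_inv_iff (extend_ne_zero I)]
  constructor
  · intro h
    obtain ⟨a, ha, ha0⟩ := fractionalIdeal_exists_mem_ne_zero hI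
    have h0 : algebraMap K L a ≠ 0 := by simpa using ha0
    obtain ⟨r, hr⟩ := (FractionalIdeal.mem_one_iff _).1 (h _ (polyMap_C_mem_extend.2 ha))
    have hx : x = polyMap D F (C (algebraMap K L a)⁻¹ * (r : L[X])) := by
      rw [map_mul, polyMap_coe, hr, mul_left_comm, ← map_mul, ← C_mul, inv_mul_cancel₀ h0]
      simp
    obtain ⟨d, hd⟩ := r.2
    have hc : algebraMap K L (a⁻¹ * algebraMap D K d) =
        (C (algebraMap K L a)⁻¹ * (r : L[X])).coeff 0 := by
      rw [coeff_C_mul, map_mul, map_inv₀, ← IsScalarTower.algebraMap_apply, hd,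
        constantCoeff_apply]
    rw [hx]
    refine polyMap_mem_extend.2 ⟨_, (FractionalIdeal.mem_inv_iff hI).2 fun b hb => ?_, hc⟩
    have hb' := h _ (polyMap_C_mem_extend.2 hb)
    rw [hx, ← map_mul, polyMap_mem_one] at hb'
    obtain ⟨e, he⟩ := hb'
    rw [constantCoeff_apply, coeff_mul_C, ← hc, ← map_mul,
      IsScalarTower.algebraMap_apply D K L] at he
    exact (FractionalIdeal.mem_one_iff _).2 ⟨e, (algebraMap K L).injective he⟩
  · rintro ⟨f, ⟨a, ha, hf⟩, rfl⟩ _ ⟨g, ⟨b, hb, hg⟩, rfl⟩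
    rw [← map_mul, polyMap_mem_one]
    obtain ⟨d, hd⟩ := (FractionalIdeal.mem_one_iff _).1 ((FractionalIdeal.mem_inv_iff hI).1 ha b hb)
    refine ⟨d, ?_⟩
    rw [constantCoeff_apply, mul_coeff_zero, ← hf, ← hg, ← map_mul, ← hd,
      ← IsScalarTower.algebraMap_apply]

theorem vClosure_extend {I : FractionalIdeal D⁰ K} (hI : I ≠ 0) :
    vClosure (extend L F I) = extend L F (vClosure I) := by
  rw [vClosure, extend_inv hI, extend_inv (inv_ne_zero_of_ne_zero hI), vClosure]

theorem extend_eq_span {I : FractionalIdeal D⁰ K} (hI : I ≠ 0) {s : Set K}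
    (hs : Submodule.span D s = I) : (extend L F I : Submodule (dPlusXL D L) F) =
      Submodule.span (dPlusXL D L) ((fun a => polyMap D F (C (algebraMap K L a))) '' s) := by
  refine le_antisymm ?_ (Submodule.span_le.2 ?_)
  · have hC : ∀ a ∈ Submodule.span D s, polyMap D F (C (algebraMap K L a)) ∈
        Submodule.span (dPlusXL D L) ((fun a => polyMap D F (C (algebraMap K L a))) '' s) := by
      intro a ha
      induction ha using Submodule.span_induction with
      | mem a ha => exact Submodule.subset_span ⟨a, ha, rfl⟩
      | zero => simp
      | add a b _ _ ha hb =>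
        rw [map_add, C_add, map_add]
        exact Submodule.add_mem _ ha hb
      | smul d a _ ha =>
        have := Submodule.smul_mem _ (constants D L d) ha
        rwa [Algebra.smul_def, ← polyMap_coe, ← map_mul, coe_constants, ← C_mul,
          IsScalarTower.algebraMap_apply D K L, ← map_mul, ← Algebra.smul_def] at this
    rw [hs] at hC
    obtain ⟨b, hb, hb0⟩ := fractionalIdeal_exists_mem_ne_zero hI
    have h0 : algebraMap K L b ≠ 0 := by simpa using hb0
    rintro _ ⟨f, ⟨a, ha, hf⟩, rfl⟩
    obtain ⟨g, hg⟩ := X_dvd_iff.2 (show (f - C (f.coeff 0)).coeff 0 = 0 by simp)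
    -- One nonzero b in I generates all of XL[X]: Xg = (X b⁻¹g) · b.
    have e : f = X * (C (algebraMap K L b)⁻¹ * g) * C (algebraMap K L b) +
        C (algebraMap K L a) := by
      rw [hf, ← sub_eq_iff_eq_add, hg, mul_assoc, mul_right_comm, ← C_mul, inv_mul_cancel₀ h0,
        C_1, one_mul]
    have h1 := Submodule.smul_mem _ (⟨X * (C (algebraMap K L b)⁻¹ * g),
      mul_mem_of_coeff_zero (by simp)⟩ : dPlusXL D L) (hC b hb)
    rw [Algebra.smul_def, ← polyMap_coe, ← map_mul] at h1
    rw [e, map_add]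
    exact Submodule.add_mem _ h1 (hC a ha)
  · rintro _ ⟨a, ha, rfl⟩
    exact polyMap_C_mem_extend.2
      (show a ∈ (I : Submodule D K) from hs ▸ Submodule.subset_span ha)

theorem fg_extend {I : FractionalIdeal D⁰ K} (hI : I ≠ 0) (hf : (I : Submodule D K).FG) :
    (extend L F I : Submodule (dPlusXL D L) F).FG := by
  classical
  obtain ⟨s, hs⟩ := hf
  rw [extend_eq_span hI hs]
  exact Submodule.fg_span (s.finite_toSet.image _)

/-- The constant coefficients of generators of G suffice, as every extension contains XL[X]; a
nonzero b in I is adjoined to keep J nonzero for `vClosure_extend`. -/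
theorem exists_fg_le_extend {I : FractionalIdeal D⁰ K} (hI : I ≠ 0)
    {G : FractionalIdeal (dPlusXL D L)⁰ F} (hG : (G : Submodule (dPlusXL D L) F).FG)
    (h : G ≤ extend L F I) :
    ∃ J ≤ I, J ≠ 0 ∧ (J : Submodule D K).FG ∧ G ≤ extend L F J := by
  classical
  obtain ⟨b, hb, hb0⟩ := fractionalIdeal_exists_mem_ne_zero hI
  obtain ⟨s, hs⟩ := hG
  have key : ∀ s : Finset F, (∀ x ∈ s, x ∈ extend L F I) →
      ∃ J ≤ I, J ≠ 0 ∧ (J : Submodule D K).FG ∧ ∀ x ∈ s, x ∈ extend L F J := by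
    intro s
    induction s using Finset.induction_on with
    | empty =>
      exact fun _ => ⟨FractionalIdeal.spanSingleton D⁰ b,
        FractionalIdeal.spanSingleton_le_iff_mem.2 hb, FractionalIdeal.spanSingleton_ne_zero_iff.2 hb0,
        fg_spanSingleton b,
        by simp⟩
    | insert x s _ ih =>
      intro hs
      obtain ⟨J, hJ, hJ0, hJf, hJs⟩ := ih fun y hy => hs y (Finset.mem_insert_of_mem hy)
      obtain ⟨f, ⟨a, ha, hf⟩, rfl⟩ := hs x (Finset.mem_insert_self x s)
      refine ⟨J ⊔ FractionalIdeal.spanSingleton D⁰ a,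
        sup_le hJ (FractionalIdeal.spanSingleton_le_iff_mem.2 ha),
        fun h0 => hJ0 (le_antisymm (h0 ▸ le_sup_left) zero_le), ?_, fun y hy => ?_⟩
      · rw [FractionalIdeal.coe_sup]
        exact hJf.sup (fg_spanSingleton a)
      · rcases Finset.mem_insert.1 hy with rfl | hy
        · exact ⟨f, ⟨a, (le_sup_right : _ ≤ J ⊔ FractionalIdeal.spanSingleton D⁰ a)
            (FractionalIdeal.mem_spanSingleton_self D⁰ a), hf⟩, rfl⟩
        · exact extend_le_extend.2 le_sup_left (hJs y hy)
  obtain ⟨J, hJ, hJ0, hJf, hJs⟩ := key s fun x hx => h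
    (show x ∈ (G : Submodule (dPlusXL D L) F) from hs ▸ Submodule.subset_span hx)
  refine ⟨J, hJ, hJ0, hJf, ?_⟩
  rw [← FractionalIdeal.coe_le_coe, ← hs, Submodule.span_le]
  exact hJs

/-- Extensions of nonzero finitely generated J ⊆ I are cofinal among the finitely generated
subideals of I + XL[X], and on them `vClosure_extend` applies. -/
theorem tClosure_extend {I : FractionalIdeal D⁰ K} (hI : I ≠ 0) :
    tClosure (extend L F I) = extend L F (tClosure I) := by
  apply le_antisymm
  · rintro x ⟨G, hG, hGf, hx⟩
    obtain ⟨J, hJ, hJ0, hJf, hGJ⟩ := exists_fg_le_extend hI hGf hG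
    have hx' := vClosure_mono hGJ hx
    rw [vClosure_extend hJ0] at hx'
    exact extend_le_extend.2 (fun y hy => mem_tClosure.2 ⟨J, hJ, hJf, hy⟩) hx'
  · rintro _ ⟨f, ⟨a, ⟨J, hJ, hJf, ha⟩, hf⟩, rfl⟩
    obtain ⟨b, hb, hb0⟩ := fractionalIdeal_exists_mem_ne_zero hI
    have h0 : J ⊔ FractionalIdeal.spanSingleton D⁰ b ≠ 0 := fun h0 => hb0 <| by
      rw [← FractionalIdeal.spanSingleton_eq_zero_iff (S := D⁰)]
      exact le_antisymm (h0 ▸ le_sup_right) zero_le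
    refine ⟨extend L F (J ⊔ FractionalIdeal.spanSingleton D⁰ b), extend_le_extend.2
      (sup_le hJ (FractionalIdeal.spanSingleton_le_iff_mem.2 hb)), fg_extend h0 ?_, ?_⟩
    · rw [FractionalIdeal.coe_sup]
      exact hJf.sup (fg_spanSingleton b)
    · rw [vClosure_extend h0]
      exact ⟨f, ⟨a, vClosure_mono le_sup_left ha, hf⟩, rfl⟩

theorem coeIdeal_comap_constTerm [FaithfulSMul D L] (J : Ideal D) :
    (J.comap (constTerm D L) : FractionalIdeal (dPlusXL D L)⁰ F) =
      extend L F (J : FractionalIdeal D⁰ K) := by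
  ext x
  rw [FractionalIdeal.mem_coeIdeal]
  constructor
  · rintro ⟨r, hr, rfl⟩
    rw [← polyMap_coe, polyMap_mem_extend]
    exact ⟨_, FractionalIdeal.mem_coeIdeal_of_mem _ hr, by
      rw [← IsScalarTower.algebraMap_apply, algebraMap_constTerm]⟩
  · rintro ⟨f, ⟨_, ⟨d, hd, rfl⟩, hf⟩, rfl⟩
    have hf' : algebraMap D L d = f.coeff 0 := by
      rw [← hf, IsScalarTower.algebraMap_apply D K L]; rfl
    refine ⟨⟨f, d, hf'⟩, ?_, (polyMap_coe _).symm⟩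
    have h : constTerm D L ⟨f, d, hf'⟩ = d := constTerm_eq_iff.2 hf'.symm
    exact Ideal.mem_comap.2 (h.symm ▸ hd)

end Extension

end DPlusXL

namespace DPlusXL

/-! ### Descent and ascent of the sub-almost conditions -/

section Main

variable {D K L F : Type*} [CommRing D] [IsDomain D]
    [Field K] [Algebra D K] [IsFractionRing D K]
    [Field L] [Algebra K L] [Algebra D L] [IsScalarTower D K L] [FaithfulSMul D L]
    [Field F] [Algebra (dPlusXL D L) F] [IsFractionRing (dPlusXL D L) F]

/-- The common shape of the `*`-SAB and `*`-SAP conditions: `Q` is the property required of the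
ideal between a power of a finitely generated ideal and its prime `*`-ideals. -/
def IsSubAlmost {A K : Type*} [CommRing A] [IsDomain A] [Field K] [Algebra A K]
    [IsFractionRing A K] (s : StarOperation A K) (Q : Ideal A → Prop) : Prop :=
  ∀ S : Finset A, S.Nonempty → (∀ x ∈ S, x ≠ 0) →
    ∃ n : ℕ, 0 < n ∧ ∃ J : Ideal A, Q J ∧
      Ideal.span (S : Set A) ^ n ≤ J ∧ InEachPrimeStarIdealOver s (Ideal.span (S : Set A)) J

/-- A star operation on `D` and one on `D + X L[X]` are compatible if the extension of fractional
ideals commutes with them. -/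
def Compatible (s : StarOperation D K) (s' : StarOperation (dPlusXL D L) F) : Prop :=
  ∀ I : FractionalIdeal D⁰ K, I ≠ 0 → s'.star (extend L F I) = extend L F (s.star I)

theorem compatible_dOperation : Compatible (dOperation D K) (dOperation (dPlusXL D L) F) :=
  fun _ _ => rfl

theorem compatible_tOperation : Compatible (tOperation D K) (tOperation (dPlusXL D L) F) :=
  fun _ hI => tClosure_extend hI

variable {s : StarOperation D K} {s' : StarOperation (dPlusXL D L) F}

theorem isStarIdeal_extend_iff (h : Compatible s s') {I : FractionalIdeal D⁰ K} (hI : I ≠ 0) :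
    IsStarIdeal s' (extend L F I) ↔ IsStarIdeal s I := by
  rw [IsStarIdeal, IsStarIdeal, h I hI, extend_injective.eq_iff]
  simp only [hI, extend_ne_zero, ne_eq, not_false_eq_true]

theorem isStarInvertible_extend_iff (h : Compatible s s') {I : FractionalIdeal D⁰ K}
    (hI : I ≠ 0) : IsStarInvertible s' (extend L F I) ↔ IsStarInvertible s I := by
  have h1 : I * I⁻¹ ≠ 0 := by
    obtain ⟨a, ha, ha0⟩ := fractionalIdeal_exists_mem_ne_zero hI
    obtain ⟨b, hb, hb0⟩ := fractionalIdeal_exists_mem_ne_zero (inv_ne_zero_of_ne_zero hI)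
    intro h0
    have := FractionalIdeal.mul_mem_mul ha hb
    rw [h0, FractionalIdeal.mem_zero_iff] at this
    exact mul_ne_zero ha0 hb0 this
  rw [IsStarInvertible, IsStarInvertible, extend_inv hI, ← extend_mul hI, h _ h1,
    ← extend_one (K := K), extend_injective.eq_iff]
  simp only [hI, extend_ne_zero, ne_eq, not_false_eq_true]

theorem isStarIdeal_comap_iff (h : Compatible s s') {J : Ideal D} (hJ : J ≠ ⊥) :
    IsStarIdeal s' (J.comap (constTerm D L) : FractionalIdeal (dPlusXL D L)⁰ F) ↔
      IsStarIdeal s (J : FractionalIdeal D⁰ K) := by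
  rw [coeIdeal_comap_constTerm (K := K),
    isStarIdeal_extend_iff h (FractionalIdeal.coeIdeal_ne_zero.2 hJ)]

theorem isStarInvertible_comap_iff (h : Compatible s s') {J : Ideal D} (hJ : J ≠ ⊥) :
    IsStarInvertible s' (J.comap (constTerm D L) : FractionalIdeal (dPlusXL D L)⁰ F) ↔
      IsStarInvertible s (J : FractionalIdeal D⁰ K) := by
  rw [coeIdeal_comap_constTerm (K := K),
    isStarInvertible_extend_iff h (FractionalIdeal.coeIdeal_ne_zero.2 hJ)]

/-- Descent of the sub-almost conditions from `D + X L[X]` to `D`. -/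
theorem IsSubAlmost.of_dPlusXL (h : Compatible s s') {Q : Ideal D → Prop}
    {Q' : Ideal (dPlusXL D L) → Prop}
    (hQ : ∀ J : Ideal D, J ≠ ⊥ → Q' (J.comap (constTerm D L)) → Q J)
    (hs : IsSubAlmost s' Q') : IsSubAlmost s Q := by
  classical
  intro S hS hS0
  obtain ⟨n, hn, J, hJ, hSJ, hJP⟩ := hs (S.image (constants D L)) (hS.image _) (by
    simp only [Finset.mem_image]
    rintro _ ⟨x, hx, rfl⟩ h0
    exact hS0 x hx (by simpa using congrArg (constTerm D L) h0))
  rw [Finset.coe_image, ← Ideal.map_span] at hSJ hJP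
  obtain ⟨c, hc⟩ := hS
  -- A nonzero constant in J forces XL[X] ⊆ J, so J comes from an ideal of D.
  have hcJ : constants D L (c ^ n) ∈ J := hSJ <| by
    rw [map_pow]
    exact Ideal.pow_mem_pow (Ideal.mem_map_of_mem _ (Ideal.subset_span hc)) n
  have hc0 : c ^ n ≠ 0 := pow_ne_zero n (hS0 c hc)
  have hJeq := comap_constTerm_comap_constants (ker_le_of_constants_mem hc0 hcJ)
  refine ⟨n, hn, J.comap (constants D L), hQ _ ?_ (by rwa [hJeq]), ?_, ?_⟩
  · exact fun h0 => hc0 (by simpa [h0] using Ideal.mem_comap.2 hcJ)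
  · rw [← Ideal.map_le_iff_le_comap, Ideal.map_pow]
    exact hSJ
  · intro P hP hPs hSP
    have hP0 : P ≠ ⊥ := FractionalIdeal.coeIdeal_ne_zero.1 hPs.1
    have := hJP (P.comap (constTerm D L)) inferInstance ((isStarIdeal_comap_iff h hP0).2 hPs) (by
      rw [Ideal.map_le_iff_le_comap, comap_constants_comap_constTerm]
      exact hSP)
    have h2 := Ideal.comap_mono (f := constants D L) this
    rwa [comap_constants_comap_constTerm] at h2

/-- L[X] is a principal ideal ring; scaling a generator by a unit of L makes a nonzero constant
coefficient 1, which places the generator in R. -/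
theorem exists_normalized_generator {I : Ideal (dPlusXL D L)} (hI : I ≠ ⊥) :
    ∃ f : dPlusXL D L, f ≠ 0 ∧
      I.map (dPlusXL D L).subtype = Ideal.span {(f : L[X])} ∧
      ((f : L[X]).coeff 0 = 0 ∨ (f : L[X]).coeff 0 = 1) := by
  obtain ⟨f, hf⟩ := IsPrincipalIdealRing.principal (I.map (dPlusXL D L).subtype)
  rw [Ideal.submodule_span_eq] at hf
  have hf0 : f ≠ 0 := by
    rintro rfl
    obtain ⟨r, hr, hr0⟩ := Submodule.exists_mem_ne_zero_of_ne_bot hI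
    have := Ideal.mem_map_of_mem (dPlusXL D L).subtype hr
    rw [hf, Ideal.mem_span_singleton, zero_dvd_iff] at this
    exact hr0 (Subtype.ext this)
  by_cases h0 : f.coeff 0 = 0
  · exact ⟨⟨f, mul_mem_of_coeff_zero h0⟩, fun h => hf0 (congrArg Subtype.val h), hf, Or.inl h0⟩
  · have hu : IsUnit (C (f.coeff 0)⁻¹) := isUnit_C.2 (inv_ne_zero h0).isUnit
    have h1 : (C (f.coeff 0)⁻¹ * f).coeff 0 = 1 := by rw [coeff_C_mul, inv_mul_cancel₀ h0]
    refine ⟨⟨C (f.coeff 0)⁻¹ * f, 1, by rw [map_one, constantCoeff_apply, h1]⟩,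
      fun h => mul_ne_zero hu.ne_zero hf0 (congrArg Subtype.val h), ?_, Or.inr h1⟩
    rw [hf, Ideal.span_singleton_mul_left_unit hu]

/-- Ascent of the sub-almost conditions from `D` to `D + X L[X]`. -/
theorem IsSubAlmost.to_dPlusXL (h : Compatible s s') {Q : Ideal D → Prop}
    {Q' : Ideal (dPlusXL D L) → Prop}
    (hQ : ∀ J : Ideal D, J ≠ ⊥ → Q J → Q' (J.comap (constTerm D L)))
    (hQmul : ∀ (f : dPlusXL D L) (J : Ideal (dPlusXL D L)), f ≠ 0 → Q' J →
      Q' (Ideal.span {f} * J))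
    (hQ1 : Q' ⊤)
    (hs : IsSubAlmost s Q) : IsSubAlmost s' Q' := by
  classical
  intro S hS hS0
  obtain ⟨x₀, hx₀⟩ := hS
  set I := Ideal.span (S : Set (dPlusXL D L)) with hIdef
  have hx₀I : x₀ ∈ I := Ideal.subset_span hx₀
  have hI : I ≠ ⊥ := fun h0 => hS0 x₀ hx₀ (by simpa [h0] using hx₀I)
  obtain ⟨f, hf0, hf, hf'⟩ := exists_normalized_generator hI
  have hdvd : ∀ x ∈ I, (f : L[X]) ∣ x := fun x hx => by
    have := Ideal.mem_map_of_mem (dPlusXL D L).subtype hx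
    rwa [hf, Ideal.mem_span_singleton] at this
  have hmul : ∀ g : dPlusXL D L, (g : L[X]).coeff 0 = 0 → g * f ∈ I := fun g hg =>
    mul_mem_of_mem_map (hf ▸ Ideal.mem_span_singleton_self _) hg rfl
  rcases hf' with hfc | hfc
  -- Exponent 2 suffices: (fg)(fk) = f · (fgk), and fgk has zero constant coefficient because f
  -- does.
  · refine ⟨2, two_pos, Ideal.span {f} * ⊤, hQmul f ⊤ hf0 hQ1, ?_, ?_⟩
    · rw [Ideal.mul_top, pow_two, Ideal.mul_le]
      intro x hx y hy
      obtain ⟨g, hg⟩ := hdvd x hx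
      obtain ⟨k, hk⟩ := hdvd y hy
      refine Ideal.mem_span_singleton.2 ⟨⟨f * (g * k), mul_mem_of_coeff_zero (by simp [hfc])⟩,
        Subtype.ext ?_⟩
      simp only [Subring.coe_mul, hg, hk]
      ring
    · intro P hP _ hIP
      rw [Ideal.mul_top, Ideal.span_singleton_le_iff_mem]
      rcases hP.mem_or_mem (hIP (hmul (varX D) (by simp))) with hX | hfP
      · exact ker_le_of_varX_mem hP hX (mem_ker_constTerm.2 hfc)
      · exact hfP
  · have hfc' : constTerm D L f = 1 := by rw [constTerm_eq_iff, hfc, map_one]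
    have hquot : ∀ x ∈ I, ∃ y, x = f * y ∧ constTerm D L y = constTerm D L x := by
      intro x hx
      obtain ⟨y, hy⟩ := hdvd x hx
      have hy' : (x : L[X]).coeff 0 = y.coeff 0 := by rw [hy, mul_coeff_zero, hfc, one_mul]
      have e : x = f * ⟨y, constTerm D L x, by
        rw [algebraMap_constTerm, hy', constantCoeff_apply]⟩ := Subtype.ext hy
      refine ⟨_, e, ?_⟩
      conv_rhs => rw [e, map_mul, hfc', one_mul]
    -- The hypothesis on D accepts only nonzero elements; erasing 0 leaves the generated ideal
    -- unchanged.
    set T := (S.image (constTerm D L)).erase 0 with hT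
    have hspan : Ideal.span (T : Set D) = I.map (constTerm D L) := by
      rw [hT, Finset.coe_erase, Ideal.span_sdiff_singleton_zero, Finset.coe_image,
        ← Ideal.map_span]
    have hTne : T.Nonempty := by
      rw [Finset.nonempty_iff_ne_empty]
      intro hTe
      rw [hTe, Finset.coe_empty, Ideal.span_empty, eq_comm, Ideal.map_eq_bot_iff_le_ker] at hspan
      -- If all constant terms of I vanished, X would divide f, against f(0) = 1.
      have hle : I.map (dPlusXL D L).subtype ≤ Ideal.span {(X : L[X])} := by
        rw [Ideal.map_le_iff_le_comap]
        intro x hx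
        exact Ideal.mem_span_singleton.2 (X_dvd_iff.2 (mem_ker_constTerm.1 (hspan hx)))
      rw [hf, Ideal.span_singleton_le_iff_mem, Ideal.mem_span_singleton, X_dvd_iff, hfc] at hle
      exact one_ne_zero hle
    obtain ⟨n, hn, J, hJ, hTJ, hJP⟩ := hs T hTne fun x hx => Finset.ne_of_mem_erase hx
    have hT0 : Ideal.span (T : Set D) ≠ ⊥ := by
      obtain ⟨t, ht⟩ := hTne
      exact fun h0 => Finset.ne_of_mem_erase ht (by simpa [h0] using Ideal.subset_span ht)
    have hJ0 : J ≠ ⊥ := fun h0 => pow_ne_zero n hT0 (le_bot_iff.1 (h0 ▸ hTJ))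
    rw [hspan] at hTJ hJP hT0
    refine ⟨n, hn, Ideal.span {f} * J.comap (constTerm D L), hQmul f _ hf0 (hQ J hJ0 hJ), ?_, ?_⟩
    · have hle : I ≤ Ideal.span {f} * (I.map (constTerm D L)).comap (constTerm D L) := by
        intro x hx
        obtain ⟨y, hy, hyx⟩ := hquot x hx
        rw [hy]
        refine Ideal.mul_mem_mul (Ideal.mem_span_singleton_self f) ?_
        rw [Ideal.mem_comap, hyx]
        exact Ideal.mem_map_of_mem _ hx
      calc I ^ n ≤ (Ideal.span {f} * (I.map (constTerm D L)).comap (constTerm D L)) ^ n :=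
            Ideal.pow_right_mono hle n
        _ = Ideal.span {f} ^ n * ((I.map (constTerm D L)).comap (constTerm D L)) ^ n :=
            mul_pow _ _ _
        _ ≤ Ideal.span {f} * J.comap (constTerm D L) :=
            Ideal.mul_mono (Ideal.pow_le_self hn.ne')
              ((Ideal.le_comap_pow _ n).trans (Ideal.comap_mono hTJ))
    · intro P hP hPs hIP
      by_cases hfP : f ∈ P
      · exact Ideal.mul_le_left.trans ((Ideal.span_singleton_le_iff_mem _).2 hfP)
      refine Ideal.mul_le_right.trans ?_
      -- For g in XL[X], gf lies in I ⊆ P; as f is not in P, g is.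
      have hker : RingHom.ker (constTerm D L) ≤ P := fun g hg =>
        (hP.mem_or_mem (hIP (hmul g (mem_ker_constTerm.1 hg)))).resolve_right hfP
      have hPeq := comap_constTerm_comap_constants hker
      have hIP' : I.map (constTerm D L) ≤ P.comap (constants D L) := by
        rw [Ideal.map_le_iff_le_comap, hPeq]
        exact hIP
      have hP0 : P.comap (constants D L) ≠ ⊥ := fun h0 => hT0 (le_bot_iff.1 (h0 ▸ hIP'))
      rw [← hPeq] at hPs ⊢
      exact Ideal.comap_mono
        (hJP _ inferInstance ((isStarIdeal_comap_iff h hP0).1 hPs) hIP')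

/-- Principality ascends by `isPrincipal_comap_constTerm` and descends because J is the image of its
preimage under the surjection R → D. -/
theorem isSubAlmostBezout_iff (h : Compatible s s') :
    IsSubAlmostBezout s ↔ IsSubAlmostBezout s' := by
  refine ⟨IsSubAlmost.to_dPlusXL h (fun J h0 hJ => isPrincipal_comap_constTerm hJ h0) ?_
    (⟨1, by rw [Ideal.submodule_span_eq, Ideal.span_singleton_one]⟩), IsSubAlmost.of_dPlusXL h fun J _ hJ => ?_⟩
  · rintro f J - ⟨g, rfl⟩
    exact ⟨f * g, by
      rw [Ideal.submodule_span_eq, Ideal.submodule_span_eq, Ideal.span_singleton_mul_span_singleton]⟩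
  · obtain ⟨r, hr⟩ := hJ
    refine ⟨constTerm D L r, ?_⟩
    rw [← Ideal.map_comap_of_surjective (constTerm D L) constTerm_surjective J, hr, Ideal.submodule_span_eq,
      Ideal.submodule_span_eq, Ideal.map_span, Set.image_singleton]

/-- Since (xI)⁻¹ = x⁻¹I⁻¹, the product of the ideal with its inverse is unchanged. This serves the
factor f in the ascent. -/
theorem isStarInvertible_spanSingleton_mul {A K : Type*} [CommRing A] [IsDomain A] [Field K]
    [Algebra A K] [IsFractionRing A K] {s : StarOperation A K} {x : K} (hx : x ≠ 0)
    {I : FractionalIdeal A⁰ K} (hI : IsStarInvertible s I) :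
    IsStarInvertible s (FractionalIdeal.spanSingleton A⁰ x * I) := by
  have e : FractionalIdeal.spanSingleton A⁰ x * I *
      (FractionalIdeal.spanSingleton A⁰ x⁻¹ * I⁻¹) = I * I⁻¹ := by
    rw [mul_mul_mul_comm, FractionalIdeal.spanSingleton_mul_spanSingleton, mul_inv_cancel₀ hx,
      FractionalIdeal.spanSingleton_one, one_mul]
  refine ⟨fun h0 => ?_, ?_⟩
  · obtain ⟨a, ha, ha0⟩ := fractionalIdeal_exists_mem_ne_zero hI.1
    have := FractionalIdeal.mul_mem_mul (FractionalIdeal.mem_spanSingleton_self A⁰ x) ha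
    rw [h0, FractionalIdeal.mem_zero_iff] at this
    exact mul_ne_zero hx ha0 this
  · rw [inv_spanSingleton_mul hx hI.1, e]
    exact hI.2

theorem isSubAlmostPrufer_iff (h : Compatible s s') :
    IsSubAlmostPrufer s ↔ IsSubAlmostPrufer s' := by
  refine ⟨IsSubAlmost.to_dPlusXL h (fun J h0 hJ => ⟨(isStarInvertible_comap_iff h h0).2 hJ.1,
    (isStarIdeal_comap_iff h h0).2 hJ.2⟩) ?_ ?_, IsSubAlmost.of_dPlusXL h fun J h0 hJ =>
    ⟨(isStarInvertible_comap_iff h h0).1 hJ.1, (isStarIdeal_comap_iff h h0).1 hJ.2⟩⟩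
  · rintro f J hf ⟨hJ, hJ'⟩
    have hx : algebraMap (dPlusXL D L) F f ≠ 0 := by simpa using hf
    rw [FractionalIdeal.coeIdeal_mul, FractionalIdeal.coeIdeal_span_singleton]
    have h1 := isStarInvertible_spanSingleton_mul hx hJ
    exact ⟨h1, h1.1, by rw [s'.star_smul _ _ hx hJ.1, hJ'.2]⟩
  · have h1 : s'.star 1 = 1 := by
      simpa using s'.star_principal 1 one_ne_zero
    rw [FractionalIdeal.coeIdeal_top]
    exact ⟨⟨one_ne_zero, by simpa using h1⟩, one_ne_zero, h1⟩

end Main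

end DPlusXL

theorem mainTheorem4 (D K L : Type*) [CommRing D] [IsDomain D]
    [Field K] [Algebra D K] [IsFractionRing D K]
    [Field L] [Algebra K L] [Algebra D L] [IsScalarTower D K L] :
    (IsSubAlmostBezout (dOperation D K) ↔
      IsSubAlmostBezout (dOperation (dPlusXL D L) (FractionRing (dPlusXL D L)))) ∧
    (IsSubAlmostPrufer (dOperation D K) ↔
      IsSubAlmostPrufer (dOperation (dPlusXL D L) (FractionRing (dPlusXL D L)))) ∧
    (IsSubAlmostBezout (tOperation D K) ↔
      IsSubAlmostBezout (tOperation (dPlusXL D L) (FractionRing (dPlusXL D L)))) ∧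
    (IsSubAlmostPrufer (tOperation D K) ↔
      IsSubAlmostPrufer (tOperation (dPlusXL D L) (FractionRing (dPlusXL D L)))) := by
  have : FaithfulSMul D L := (faithfulSMul_iff_algebraMap_injective D L).2 <| by
    rw [IsScalarTower.algebraMap_eq D K L]
    exact (algebraMap K L).injective.comp (IsFractionRing.injective D K)
  exact ⟨DPlusXL.isSubAlmostBezout_iff DPlusXL.compatible_dOperation,
    DPlusXL.isSubAlmostPrufer_iff DPlusXL.compatible_dOperation,
    DPlusXL.isSubAlmostBezout_iff DPlusXL.compatible_tOperation,
    DPlusXL.isSubAlmostPrufer_iff DPlusXL.compatible_tOperation⟩
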